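/- Let $T^2=\mathbb R^2/\mathbb Z^2$ carry its flat metric of volume $1$, orthonormal frame $v_j=\partial_{x^j}$, and trivial spin structure, so that the space $V$ of smooth spinors is $C^\infty(T^2,\mathbb C^2)$, with covariant derivative $\nabla_{v_j}=\partial_{x^j}$, with the vectors $v_1,v_2$ acting by Clifford multiplication through anti-hermitian matrices with $v_i\cdot v_j\cdot+\,v_j\cdot v_i\cdot=-2\delta_{ij}$ (concretely $\gamma_1=\begin{pmatrix}0&-i\\-i&0\end{pmatrix}$, $\gamma_2=\begin{pmatrix}0&-1\\1&0\end{pmatrix}$), and with the $L^2$ inner product $\langle\phi,\psi\rangle=\int_{T^2}\phi^\dagger\psi$. Let $D=\sum_j v_j\cdot\nabla_{v_j}$ be the Dirac operator, $\Gamma\psi=i\,v_1\cdot v_2\cdot\psi$ the chirality operator, $V^\pm=\{\psi\in V:\Gamma\psi=\pm\psi\}$ and $\psi^\pm=\tfrac12(\psi\pm\Gamma\psi)$. The group $T^2$ (the identity component of the isometry group) acts on spinors by translations. For a smooth vector field $X$ the Kosmann–Lichnerowicz derivative is $$\mathscr L_X\psi=\nabla_X\psi-\tfrac18\sum_{i,j}\big[g(\nabla_{v_i}X,v_j)-g(\nabla_{v_j}X,v_i)\big]\,v_i\cdot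 v_j\cdot\psi ;$$ it preserves $V^\pm$, and $\mathscr L_X^\pm$ denotes its restriction to $V^\pm$. - $\mathscr L_X$ has *weak chiral symmetry* if there is an invertible, unitary (for the $L^2$ inner product), $T^2$-equivariant linear map $\Theta:V^+\to V^-$ that commutes with $D^2$ and satisfies $\Theta^{-1}\mathscr L_X^-\Theta=\mathscr L_X^+$. - $\mathscr L_X$ has *strong chiral symmetry* if (1) $\langle\phi^+,\mathscr L_X\psi^+\rangle=\langle\phi^-,\mathscr L_X\psi^-\rangle$ for all $\phi,\psi\in V_{m>0}$, the space of smooth spinors that are $L^2$-orthogonal to all eigenspinors of $D$ with eigenvalue $m\le 0$; (2) $\mathscr L_X$ preserves $\ker D$; and (3) there is a unitary, $T^2$-equivariant linear isomorphism $\Theta_0:\ker D\cap V^+\to\ker D\cap V^-$ with $\langle\phi,\mathscr L_X\psi\rangle=\langle\Theta_0\phi,\mathscr L_X\Theta_0\psi\rangle$ for all $\phi,\psi\in\ker D\cap V^+$. For $h\in C^\infty(T^2,\mathbb R)$ let $X_h=(\partial_{x^2}h)\,\partial_{x^1}-(\partial_{x^1}h)\,\partial_{x^2}$ be its Hamiltonian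 vector field. Then, for a generic Hamiltonian vector field, $\mathscr L_X$ has neither strong nor weak chiral symmetry. Precisely: let $U$ be the set of the Hamiltonian vector fields $X_h$ for which the Fourier coefficients of $h$ are non-zero at two linearly independent frequencies $k,l\in\mathbb Z^2$. Then $U$ is open and dense in the space of all Hamiltonian vector fields with the $C^\infty$ topology, and for every $X\in U$ the derivative $\mathscr L_X$ has neither strong nor weak chiral symmetry. -/

import Mathlib

open scoped ContDiff UniformConvergence

noncomputable section

namespace TorusSpinors

/-- The torus `T² = ℝ² / ℤ²`. -/
abbrev T2 : Type := UnitAddTorus (Fin 2)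

/-- The quotient map `ℝ² → T²`. -/
def proj (y : Fin 2 → ℝ) : T2 := fun i => (y i : UnitAddCircle)

/-- The volume measure of the flat metric on `T²`; it has total mass `1`. -/
def vol : MeasureTheory.Measure T2 :=
  MeasureTheory.Measure.pi fun _ => AddCircle.haarAddCircle

section Calculus

variable {E : Type*} [NormedAddCommGroup E] [NormedSpace ℝ E]

/-- A map on `T²` is smooth if its pull-back to `ℝ²` is. -/
def IsSmooth (f : T2 → E) : Prop := ContDiff ℝ ∞ fun y => f (proj y)

/-- The partial derivative `∂f/∂xʲ` of a map on `T²`. -/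
def pd (j : Fin 2) (f : T2 → E) : T2 → E := fun x =>
  deriv (fun t : ℝ => f (x + Pi.single j (t : UnitAddCircle))) 0

theorem proj_surjective : Function.Surjective proj := by
  intro x
  choose y hy using fun i => QuotientAddGroup.mk_surjective (x i)
  exact ⟨y, funext hy⟩

theorem proj_add_single (j : Fin 2) (y : Fin 2 → ℝ) (t : ℝ) :
    proj y + Pi.single j (t : UnitAddCircle) = proj (y + t • Pi.single j 1) := by
  funext i
  by_cases h : i = j
  · subst h; simp [proj]
  · simp [proj, h]

theorem pd_proj (j : Fin 2) {f : T2 → E} (hf : IsSmooth f) (y : Fin 2 → ℝ) :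
    pd j f (proj y) = fderiv ℝ (fun z => f (proj z)) y (Pi.single j 1) := by
  have hd : DifferentiableAt ℝ (fun z => f (proj z)) y :=
    (ContDiff.differentiable hf (by simp)).differentiableAt
  rw [← hd.lineDeriv_eq_fderiv, lineDeriv, pd]
  simp only [proj_add_single]

theorem differentiableAt_line (j : Fin 2) {f : T2 → E} (hf : IsSmooth f) (x : T2) :
    DifferentiableAt ℝ (fun t : ℝ => f (x + Pi.single j (t : UnitAddCircle))) 0 := by
  obtain ⟨y, rfl⟩ := proj_surjective x
  simp only [proj_add_single]
  have hd : Differentiable ℝ (fun z => f (proj z)) := ContDiff.differentiable hf (by simp)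
  exact (hd.comp (g := fun z => f (proj z)) (f := fun t : ℝ => y + t • Pi.single j 1)
    (by fun_prop)).differentiableAt

theorem IsSmooth.pd {f : T2 → E} (hf : IsSmooth f) (j : Fin 2) : IsSmooth (pd j f) := by
  have h : (fun y => TorusSpinors.pd j f (proj y)) =
      fun y => fderiv ℝ (fun z => f (proj z)) y (Pi.single j 1) :=
    funext fun y => pd_proj j hf y
  rw [IsSmooth, h]
  exact (ContDiff.fderiv_right (m := ∞) hf (by simp)).clm_apply contDiff_const

variable (E) in
/-- Smooth maps `T² → E`. -/
@[ext]
structure SmoothMap where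
  toFun : T2 → E
  smooth : IsSmooth toFun

/-- The `C^∞` topology on smooth maps: the coarsest one for which every partial derivative
`f ↦ ∂₁ᵃ ∂₂ᵇ f` is continuous into maps with the topology of uniform convergence. -/
instance : TopologicalSpace (SmoothMap E) :=
  TopologicalSpace.induced
    (fun (f : SmoothMap E) (a : ℕ × ℕ) =>
      UniformFun.ofFun ((pd 0)^[a.1] ((pd 1)^[a.2] f.toFun)))
    (inferInstance : TopologicalSpace (ℕ × ℕ → (T2 →ᵤ E)))

end Calculus

/-- Smooth real functions on `T²`. -/
abbrev SmoothFunction : Type := SmoothMap ℝ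

/-- Smooth vector fields `X = X¹ ∂/∂x¹ + X² ∂/∂x²` on `T²`, through their components in the
global orthonormal frame of coordinate fields; the indices are `0, 1 : Fin 2`. -/
abbrev VectorField : Type := SmoothMap (Fin 2 → ℝ)

theorem VectorField.smooth_component (X : VectorField) (j : Fin 2) :
    IsSmooth fun x => X.toFun x j :=
  contDiff_pi.1 X.smooth j

/-- The component `Xʲ`. -/
def VectorField.component (X : VectorField) (j : Fin 2) : SmoothFunction :=
  ⟨fun x => X.toFun x j, X.smooth_component j⟩

/-- `g(∇_{vᵢ} X, vⱼ) - g(∇_{vⱼ} X, vᵢ)` for the orthonormal frame `vᵢ = ∂/∂xⁱ`, whose Levi-Civita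
derivatives vanish: it equals `∂ᵢ Xʲ - ∂ⱼ Xⁱ`. -/
def VectorField.antisymmDeriv (X : VectorField) (i j : Fin 2) : SmoothFunction :=
  ⟨fun x => pd i (X.component j).toFun x - pd j (X.component i).toFun x,
    ContDiff.sub ((X.component j).smooth.pd i) ((X.component i).smooth.pd j)⟩

/-- The Hamiltonian vector field of `h`, determined by `dh = ι_{X_h} vol`:
`X_h = (∂h/∂x²) ∂/∂x¹ - (∂h/∂x¹) ∂/∂x²`. -/
def hamiltonianField (h : SmoothFunction) : VectorField :=
  ⟨fun x => ![pd 1 h.toFun x, - pd 0 h.toFun x], by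
    refine contDiff_pi.2 fun i => ?_
    fin_cases i
    · exact h.smooth.pd 1
    · exact ContDiff.neg (h.smooth.pd 0)⟩

/-- The space of Hamiltonian vector fields on `T²`, with the `C^∞` topology. -/
abbrev HamiltonianField : Type := {X : VectorField // ∃ h : SmoothFunction, X = hamiltonianField h}

/-- The space of smooth maps `T² → ℂ²`. -/
def smoothSpinors : Submodule ℂ (T2 → Fin 2 → ℂ) where
  carrier := {ψ | IsSmooth ψ}
  add_mem' {φ ψ} (hφ : IsSmooth φ) (hψ : IsSmooth ψ) := show IsSmooth (φ + ψ) from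
    ContDiff.add hφ hψ
  zero_mem' := show IsSmooth (0 : T2 → Fin 2 → ℂ) from contDiff_const
  smul_mem' c ψ (hψ : IsSmooth ψ) := show IsSmooth (c • ψ) from ContDiff.const_smul c hψ

/-- Smooth spinors on `T²`. The trivial spin structure makes the spinor bundle `T² × ℂ²`, with the
flat product connection. -/
def Spinor : Type := smoothSpinors

instance : AddCommGroup Spinor := inferInstanceAs (AddCommGroup smoothSpinors)

instance : Module ℂ Spinor := inferInstanceAs (Module ℂ smoothSpinors)

theorem Spinor.ext {φ ψ : Spinor} (h : ∀ x, φ.1 x = ψ.1 x) : φ = ψ :=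
  Subtype.ext (funext h)

/-- The gamma matrices, with `γᵢ γⱼ + γⱼ γᵢ = - 2 δᵢⱼ` and `γᵢ` anti-hermitian; they give the
Clifford action of the frame `v₁, v₂`. -/
def gam : Fin 2 → Matrix (Fin 2) (Fin 2) ℂ :=
  ![!![0, -Complex.I; -Complex.I, 0], !![0, -1; 1, 0]]

/-- A constant matrix acting on spinors. -/
def matOp (M : Matrix (Fin 2) (Fin 2) ℂ) : Module.End ℂ Spinor where
  toFun ψ := ⟨fun x => M.mulVec (ψ.1 x), by
    have h : IsSmooth ψ.1 := ψ.2
    refine (contDiff_pi.2 fun i => ?_ : IsSmooth fun x => M.mulVec (ψ.1 x))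
    simp only [Matrix.mulVec, dotProduct]
    exact ContDiff.sum fun j _ => contDiff_const.mul (contDiff_pi.1 h j)⟩
  map_add' φ ψ := by
    exact Spinor.ext fun x => Matrix.mulVec_add M (φ.1 x) (ψ.1 x)
  map_smul' c ψ := by
    exact Spinor.ext fun x => Matrix.mulVec_smul M c (ψ.1 x)

/-- Multiplication of spinors by a smooth real function. -/
def mulOp (f : SmoothFunction) : Module.End ℂ Spinor where
  toFun ψ := ⟨fun x => f.toFun x • ψ.1 x, ContDiff.smul f.smooth ψ.2⟩
  map_add' φ ψ := by
    exact Spinor.ext fun x => smul_add (f.toFun x) (φ.1 x) (ψ.1 x)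
  map_smul' c ψ := by
    exact Spinor.ext fun x => smul_comm (f.toFun x) c (ψ.1 x)

/-- The covariant derivative `∇_{vⱼ} = ∂/∂xʲ` of spinors. -/
def nabla (j : Fin 2) : Module.End ℂ Spinor where
  toFun ψ := ⟨pd j ψ.1, IsSmooth.pd ψ.2 j⟩
  map_add' φ ψ := by
    refine Spinor.ext fun x => ?_
    exact deriv_add (differentiableAt_line j φ.2 x) (differentiableAt_line j ψ.2 x)
  map_smul' c ψ := by
    refine Spinor.ext fun x => ?_
    exact deriv_const_smul c (differentiableAt_line j ψ.2 x)

/-- The Dirac operator `∑ⱼ vⱼ · ∇_{vⱼ}`. -/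
def dirac : Module.End ℂ Spinor := ∑ j, matOp (gam j) * nabla j

/-- The chirality operator `ψ ↦ i v₁ · v₂ · ψ`. -/
def chirality : Module.End ℂ Spinor := Complex.I • (matOp (gam 0) * matOp (gam 1))

/-- The Kosmann-Lichnerowicz derivative
`∇_X ψ - (1/8) ∑ᵢⱼ (g(∇_{vᵢ} X, vⱼ) - g(∇_{vⱼ} X, vᵢ)) vᵢ · vⱼ · ψ`. -/
def kosmann (X : VectorField) : Module.End ℂ Spinor :=
  ∑ j, mulOp (X.component j) * nabla j
    - (1 / 8 : ℂ) • ∑ i, ∑ j, mulOp (X.antisymmDeriv i j) * (matOp (gam i) * matOp (gam j))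

/-- The action of `a ∈ T²` on spinors by translation, `ψ ↦ ψ(· - a)`. The translations form the
identity component of the isometry group of the flat torus. -/
def translate (a : T2) : Module.End ℂ Spinor where
  toFun ψ := ⟨fun x => ψ.1 (x - a), by
    obtain ⟨b, rfl⟩ := proj_surjective a
    have h : (fun y => ψ.1 (proj y - proj b)) = fun y => ψ.1 (proj (y - b)) := by
      funext y
      congr 1
    change ContDiff ℝ ∞ (fun y => ψ.1 (proj y - proj b))
    rw [h]
    exact ContDiff.comp (g := fun y => ψ.1 (proj y)) ψ.2 (contDiff_id.sub contDiff_const)⟩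
  map_add' _ _ := rfl
  map_smul' _ _ := rfl

/-- The `L²` inner product of spinors, conjugate-linear in the first argument. -/
def l2 (φ ψ : Spinor) : ℂ := ∫ x, star (φ.1 x) ⬝ᵥ ψ.1 x ∂vol

section Commutation

theorem matOp_mul (M N : Matrix (Fin 2) (Fin 2) ℂ) : matOp M * matOp N = matOp (M * N) := by
  refine LinearMap.ext fun ψ => ?_
  refine Spinor.ext fun x => ?_
  exact Matrix.mulVec_mulVec (ψ.1 x) M N

theorem smul_matOp (c : ℂ) (M : Matrix (Fin 2) (Fin 2) ℂ) : c • matOp M = matOp (c • M) := by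
  refine LinearMap.ext fun ψ => ?_
  refine Spinor.ext fun x => ?_
  exact (Matrix.smul_mulVec c M (ψ.1 x)).symm

theorem matOp_neg (M : Matrix (Fin 2) (Fin 2) ℂ) : matOp (-M) = - matOp M := by
  refine LinearMap.ext fun ψ => ?_
  refine Spinor.ext fun x => ?_
  exact Matrix.neg_mulVec (ψ.1 x) M

theorem commute_matOp_mulOp (M : Matrix (Fin 2) (Fin 2) ℂ) (f : SmoothFunction) :
    Commute (matOp M) (mulOp f) := by
  refine LinearMap.ext fun ψ => ?_
  refine Spinor.ext fun x => ?_
  exact Matrix.mulVec_smul M (f.toFun x) (ψ.1 x)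

theorem commute_matOp_nabla (M : Matrix (Fin 2) (Fin 2) ℂ) (j : Fin 2) :
    Commute (matOp M) (nabla j) := by
  refine LinearMap.ext fun ψ => ?_
  refine Spinor.ext fun x => ?_
  have h := ((Matrix.mulVecLin M).restrictScalars ℝ).toContinuousLinearMap.hasFDerivAt.comp_hasDerivAt
    0 (differentiableAt_line j ψ.2 x).hasDerivAt
  exact h.deriv.symm

theorem chirality_eq : chirality = matOp !![1, 0; 0, -1] := by
  rw [chirality, matOp_mul, smul_matOp]
  congr 1
  ext i j
  fin_cases i <;> fin_cases j <;> simp [gam]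

theorem chirality_mul_gam (j : Fin 2) :
    chirality * matOp (gam j) = -(matOp (gam j) * chirality) := by
  rw [chirality_eq, matOp_mul, matOp_mul, ← matOp_neg]
  congr 1
  ext i k
  fin_cases j <;> fin_cases i <;> fin_cases k <;> simp [gam]

theorem chirality_mul_dirac : chirality * dirac = -(dirac * chirality) := by
  rw [dirac, Finset.mul_sum, Finset.sum_mul, ← Finset.sum_neg_distrib]
  refine Finset.sum_congr rfl fun j _ => ?_
  rw [← mul_assoc, chirality_mul_gam, mul_assoc, chirality_eq, neg_mul, mul_assoc,
    (commute_matOp_nabla _ j).eq]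

theorem commute_chirality_dirac_sq : Commute chirality (dirac * dirac) := by
  change chirality * (dirac * dirac) = dirac * dirac * chirality
  rw [← mul_assoc, chirality_mul_dirac, neg_mul, mul_assoc, chirality_mul_dirac]
  noncomm_ring

theorem commute_chirality_gam_gam (i j : Fin 2) :
    Commute chirality (matOp (gam i) * matOp (gam j)) := by
  change chirality * (matOp (gam i) * matOp (gam j)) = matOp (gam i) * matOp (gam j) * chirality
  rw [← mul_assoc, chirality_mul_gam, neg_mul, mul_assoc, chirality_mul_gam]
  noncomm_ring

theorem commute_chirality_kosmann (X : VectorField) : Commute chirality (kosmann X) := by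
  refine Commute.sub_right (R := Module.End ℂ Spinor) (Commute.sum_right _ _ _ fun j _ => ?_)
    (Commute.smul_right (Commute.sum_right _ _ _ fun i _ => Commute.sum_right _ _ _ fun j _ => ?_) _)
  · rw [chirality_eq]
    exact (commute_matOp_mulOp _ _).mul_right (commute_matOp_nabla _ _)
  · refine Commute.mul_right ?_ (commute_chirality_gam_gam i j)
    rw [chirality_eq]
    exact commute_matOp_mulOp _ _

theorem commute_chirality_translate (a : T2) : Commute chirality (translate a) := by
  rw [chirality_eq]
  rfl

theorem commute_dirac_translate (a : T2) : Commute dirac (translate a) := by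
  refine Commute.sum_left _ _ _ fun j _ => Commute.mul_left rfl ?_
  refine LinearMap.ext fun ψ => ?_
  refine Spinor.ext fun x => ?_
  change deriv (fun t : ℝ => ψ.1 (x + Pi.single j (t : UnitAddCircle) - a)) 0 =
    deriv (fun t : ℝ => ψ.1 (x - a + Pi.single j (t : UnitAddCircle))) 0
  simp only [sub_add_eq_add_sub]

end Commutation

/-- The eigenspace of the chirality operator for the eigenvalue `s`. The Weyl spinors `V⁺`, `V⁻`
are `Weyl 1`, `Weyl (-1)`. -/
abbrev Weyl (s : ℂ) : Submodule ℂ Spinor := Module.End.eigenspace chirality s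

/-- The restriction to `Weyl s` of an operator that commutes with chirality. -/
def restrictWeyl {T : Module.End ℂ Spinor} (hT : Commute chirality T) (s : ℂ) :
    Module.End ℂ (Weyl s) :=
  T.restrict (Module.End.mapsTo_genEigenspace_of_comm hT s 1)

/-- The harmonic Weyl spinors `V₀^±`, for `s = 1` and `s = -1`. -/
abbrev HarmonicWeyl (s : ℂ) : Submodule ℂ Spinor := LinearMap.ker dirac ⊓ Weyl s

theorem translate_mem_harmonicWeyl (a : T2) (s : ℂ) :
    ∀ ψ ∈ HarmonicWeyl s, translate a ψ ∈ HarmonicWeyl s := by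
  intro ψ hψ
  refine ⟨?_, Module.End.mapsTo_genEigenspace_of_comm (commute_chirality_translate a) s 1 hψ.2⟩
  have h : dirac (translate a ψ) = translate a (dirac ψ) :=
    LinearMap.congr_fun (commute_dirac_translate a).eq ψ
  change dirac (translate a ψ) = 0
  rw [h, LinearMap.mem_ker.1 hψ.1, map_zero]

/-- A chirality isomorphism: an invertible, unitary, `T²`-equivariant linear map `V⁺ → V⁻` that
commutes with the square of the Dirac operator. -/
structure IsChiralityIsomorphism (Θ : Weyl 1 ≃ₗ[ℂ] Weyl (-1)) : Prop where
  unitary : ∀ φ ψ : Weyl 1, l2 (Θ φ) (Θ ψ) = l2 φ ψ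
  equivariant : ∀ (a : T2) (ψ : Weyl 1),
    Θ (restrictWeyl (commute_chirality_translate a) 1 ψ) =
      restrictWeyl (commute_chirality_translate a) (-1) (Θ ψ)
  comm_dirac_sq : ∀ ψ : Weyl 1,
    Θ (restrictWeyl commute_chirality_dirac_sq 1 ψ) =
      restrictWeyl commute_chirality_dirac_sq (-1) (Θ ψ)

/-- The operator `L_X` has weak chiral symmetry: `Θ⁻¹ L_X⁻ Θ = L_X⁺` for some chirality
isomorphism `Θ`. -/
def HasWeakChiralSymmetry (X : VectorField) : Prop :=
  ∃ Θ : Weyl 1 ≃ₗ[ℂ] Weyl (-1), IsChiralityIsomorphism Θ ∧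
    ∀ ψ : Weyl 1, Θ.symm (restrictWeyl (commute_chirality_kosmann X) (-1) (Θ ψ)) =
      restrictWeyl (commute_chirality_kosmann X) 1 ψ

/-- The chiral components `ψ^± = (1/2) (ψ ± Γψ)`, for `s = 1` and `s = -1`. -/
def chiralPart (s : ℂ) (ψ : Spinor) : Spinor := (1 / 2 : ℂ) • (ψ + s • chirality ψ)

/-- The space `V_{m>0}` of the `L²`-orthogonal decomposition `V = V_{m>0} ⊕ V₀ ⊕ V_{m<0}`: smooth
spinors orthogonal to every eigenspinor of the Dirac operator with eigenvalue `m ≤ 0`. -/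
def IsPositiveSpinor (ψ : Spinor) : Prop :=
  ∀ m : ℝ, m ≤ 0 → ∀ φ ∈ Module.End.eigenspace dirac (m : ℂ), l2 φ ψ = 0

/-- The operator `L_X` has strong chiral symmetry. -/
structure HasStrongChiralSymmetry (X : VectorField) : Prop where
  matrix_elements : ∀ φ ψ : Spinor, IsPositiveSpinor φ → IsPositiveSpinor ψ →
    l2 (chiralPart 1 φ) (kosmann X (chiralPart 1 ψ)) =
      l2 (chiralPart (-1) φ) (kosmann X (chiralPart (-1) ψ))
  preserves_kernel : ∀ ψ ∈ LinearMap.ker dirac, kosmann X ψ ∈ LinearMap.ker dirac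
  kernel_symmetry : ∃ Θ₀ : HarmonicWeyl 1 ≃ₗ[ℂ] HarmonicWeyl (-1),
    (∀ φ ψ : HarmonicWeyl 1, l2 (Θ₀ φ) (Θ₀ ψ) = l2 φ ψ) ∧
    (∀ (a : T2) (ψ : HarmonicWeyl 1),
      Θ₀ ((translate a).restrict (translate_mem_harmonicWeyl a 1) ψ) =
        (translate a).restrict (translate_mem_harmonicWeyl a (-1)) (Θ₀ ψ)) ∧
    ∀ φ ψ : HarmonicWeyl 1, l2 φ (kosmann X ψ) = l2 (Θ₀ φ) (kosmann X (Θ₀ ψ))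

/-- The Fourier coefficient of `h` at `k ∈ ℤ²`. -/
def fourierCoefficient (h : SmoothFunction) (k : Fin 2 → ℤ) : ℂ :=
  UnitAddTorus.mFourierCoeff (fun x => (h.toFun x : ℂ)) k

/-- Two linearly independent frequencies occur in the Fourier series of `h`. -/
def HasIndependentModes (h : SmoothFunction) : Prop :=
  ∃ k l : Fin 2 → ℤ, k 0 * l 1 - k 1 * l 0 ≠ 0 ∧
    fourierCoefficient h k ≠ 0 ∧ fourierCoefficient h l ≠ 0

/-- The Hamiltonian vector fields `X_h` of the functions `h` with two linearly independent
frequencies. -/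
def genericHamiltonianFields : Set HamiltonianField :=
  {X | ∃ h : SmoothFunction, X.1 = hamiltonianField h ∧ HasIndependentModes h}

end TorusSpinors

end

noncomputable section

namespace TorusSpinors

open MeasureTheory UnitAddTorus Filter Topology

/-! In the Fourier basis `mode n i` (frequency n, chirality `sign i` = s), the matrix element of L_X
from n to n + k is -4π² ĥ(k) (n × k - s i|k|²/4), where n × k = n₀k₁ - n₁k₀
(`l2_mode_kosmann_mode`). The two chiralities differ only in the sign of the curl term.

Weak symmetry: equivariance makes Θ diagonal, with factors θₙ. Unitarity then gives, whenever ĥ(q) ≠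
0, conj(θ_{n+q}) θₙ (n × q + i|q|²/4) = n × q - i|q|²/4. From n = 0 one gets θₖ = θₗ. Comparing the
paths 0 → k → k + l and 0 → l → k + l then yields (k × l)(|k|² + |l|²) = 0, which is impossible for
independent k, l (`phases_incompatible`).

Strong symmetry: a constant spinor is harmonic, but L_X sends it to a spinor with frequency k ≠ 0 as
soon as ĥ(k) ≠ 0, whereas the upper component of a harmonic spinor has no such frequency
(`fourierCoefficient_eq_zero_of_preserves_kernel`).

Openness follows from uniform continuity of the Fourier coefficients of X; density from adding a
small multiple of cos 2πx¹ + cos 2πx² to h. -/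

instance : IsProbabilityMeasure vol :=
  inferInstanceAs (IsProbabilityMeasure (Measure.pi fun _ : Fin 2 => AddCircle.haarAddCircle))

instance : vol.IsAddLeftInvariant :=
  inferInstanceAs (Measure.pi fun _ : Fin 2 => AddCircle.haarAddCircle).IsAddLeftInvariant

theorem isQuotientMap_proj : Topology.IsQuotientMap proj :=
  (IsOpenQuotientMap.piMap fun _ : Fin 2 =>
    QuotientAddGroup.isOpenQuotientMap_mk (N := AddSubgroup.zmultiples (1 : ℝ))).isQuotientMap

/-! ### Calculus and integration on the torus -/

section Calculus

variable {E : Type*} [NormedAddCommGroup E] [NormedSpace ℝ E]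

theorem IsSmooth.continuous {f : T2 → E} (hf : IsSmooth f) : Continuous f :=
  isQuotientMap_proj.continuous_iff.2 (ContDiff.continuous hf)

theorem IsSmooth.integrable {f : T2 → E} (hf : IsSmooth f) : Integrable f vol :=
  hf.continuous.integrable_of_hasCompactSupport (HasCompactSupport.of_compactSpace f)

theorem IsSmooth.exists_norm_le {f : T2 → E} (hf : IsSmooth f) : ∃ C, ∀ x, ‖f x‖ ≤ C := by
  obtain ⟨C, hC⟩ := isCompact_univ.exists_bound_of_continuousOn hf.continuous.continuousOn
  exact ⟨C, fun x => hC x (Set.mem_univ x)⟩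

theorem hasDerivAt_line (j : Fin 2) {f : T2 → E} (hf : IsSmooth f) (x : T2) (t : ℝ) :
    HasDerivAt (fun s : ℝ => f (x + Pi.single j (s : UnitAddCircle)))
      (pd j f (x + Pi.single j (t : UnitAddCircle))) t := by
  have h := (differentiableAt_line j hf (x + Pi.single j (t : UnitAddCircle))).hasDerivAt
  rw [← sub_self t] at h
  have h' := h.comp_sub_const t t
  refine (h'.congr_of_eventuallyEq (Filter.Eventually.of_forall fun s => ?_)).congr_deriv ?_
  · change _ = f (x + Pi.single j (t : UnitAddCircle) + Pi.single j ((s - t : ℝ) : UnitAddCircle))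
    rw [add_assoc, ← Pi.single_add, ← AddCircle.coe_add, add_sub_cancel]
  · rw [sub_self]; rfl

theorem hasDerivAt_line_zero (j : Fin 2) {f : T2 → E} (hf : IsSmooth f) (x : T2) :
    HasDerivAt (fun s : ℝ => f (x + Pi.single j (s : UnitAddCircle))) (pd j f x) 0 :=
  (differentiableAt_line j hf x).hasDerivAt

theorem pd_comp_clm {F : Type*} [NormedAddCommGroup F] [NormedSpace ℝ F] (L : E →L[ℝ] F)
    (j : Fin 2) {f : T2 → E} (hf : IsSmooth f) (x : T2) :
    pd j (fun y => L (f y)) x = L (pd j f x) :=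
  (L.hasFDerivAt.comp_hasDerivAt 0 (hasDerivAt_line_zero j hf x)).deriv

theorem IsSmooth.clm_comp {F : Type*} [NormedAddCommGroup F] [NormedSpace ℝ F] (L : E →L[ℝ] F)
    {f : T2 → E} (hf : IsSmooth f) : IsSmooth fun y => L (f y) :=
  L.contDiff.comp hf

theorem pd_mul {f g : T2 → ℂ} (hf : IsSmooth f) (hg : IsSmooth g) (j : Fin 2) (x : T2) :
    pd j (fun y => f y * g y) x = pd j f x * g x + f x * pd j g x := by
  have h := (hasDerivAt_line_zero j hf x).mul (hasDerivAt_line_zero j hg x)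
  refine h.deriv.trans ?_
  simp

theorem integral_comp_add_right (f : T2 → E) (a : T2) :
    ∫ x, f (x + a) ∂vol = ∫ x, f x ∂vol :=
  integral_add_right_eq_self (μ := vol) f a

theorem hasDerivAt_integral_line (j : Fin 2) {f : T2 → E} (hf : IsSmooth f) :
    HasDerivAt (fun t : ℝ => ∫ x, f (x + Pi.single j (t : UnitAddCircle)) ∂vol)
      (∫ x, pd j f (x + Pi.single j ((0 : ℝ) : UnitAddCircle)) ∂vol) 0 := by
  obtain ⟨C, hC⟩ := (hf.pd j).exists_norm_le
  have hcont (t : ℝ) : Continuous fun x : T2 => f (x + Pi.single j (t : UnitAddCircle)) :=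
    hf.continuous.comp (continuous_add_const _)
  have hcont' : Continuous fun x : T2 => pd j f (x + Pi.single j ((0 : ℝ) : UnitAddCircle)) :=
    (hf.pd j).continuous.comp (continuous_add_const _)
  refine (hasDerivAt_integral_of_dominated_loc_of_deriv_le (μ := vol) (𝕜 := ℝ) (x₀ := 0)
    (F := fun t x => f (x + Pi.single j (t : UnitAddCircle)))
    (F' := fun t x => pd j f (x + Pi.single j (t : UnitAddCircle))) (s := Set.univ)
    (bound := fun _ => C) Filter.univ_mem ?_ ?_ ?_ ?_ ?_ ?_).2
  · exact Filter.Eventually.of_forall fun t => (hcont t).aestronglyMeasurable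
  · exact (hcont 0).integrable_of_hasCompactSupport (HasCompactSupport.of_compactSpace _)
  · exact hcont'.aestronglyMeasurable
  · exact Filter.Eventually.of_forall fun x t _ => hC _
  · exact integrable_const C
  · exact Filter.Eventually.of_forall fun x t _ => hasDerivAt_line j hf x t

/-- By translation invariance the integral of f along the flow of ∂ⱼ is constant in t; differentiate
under the integral sign. -/
theorem integral_pd (j : Fin 2) {f : T2 → E} (hf : IsSmooth f) : ∫ x, pd j f x ∂vol = 0 := by
  have h := hasDerivAt_integral_line j hf
  simp only [integral_comp_add_right f, integral_comp_add_right (pd j f)] at h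
  exact h.unique (hasDerivAt_const 0 _)

end Calculus

/-! ### Characters and Fourier coefficients of derivatives -/

section Fourier

theorem mFourier_proj (n : Fin 2 → ℤ) (y : Fin 2 → ℝ) :
    mFourier n (proj y) = Complex.exp (2 * Real.pi * Complex.I * (n 0 * y 0 + n 1 * y 1)) := by
  simp only [mFourier, ContinuousMap.coe_mk, proj, Fin.prod_univ_two, fourier_coe_apply]
  rw [← Complex.exp_add]
  congr 1
  push_cast
  ring

theorem isSmooth_mFourier (n : Fin 2 → ℤ) : IsSmooth (mFourier n) := by
  have h : (fun y => mFourier n (proj y)) = fun y : Fin 2 → ℝ =>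
      Complex.exp (2 * Real.pi * Complex.I * (n 0 * y 0 + n 1 * y 1)) :=
    funext (mFourier_proj n)
  rw [IsSmooth, h]
  have hc (i : Fin 2) : ContDiff ℝ ∞ fun y : Fin 2 → ℝ => (y i : ℂ) :=
    Complex.ofRealCLM.contDiff.comp (contDiff_apply ℝ ℝ i)
  have h0 := hc 0
  have h1 := hc 1
  fun_prop

theorem mFourier_add_apply (n : Fin 2 → ℤ) (x y : T2) :
    mFourier n (x + y) = mFourier n x * mFourier n y := by
  simp only [mFourier, ContinuousMap.coe_mk, Fin.prod_univ_two, Pi.add_apply, fourier_apply,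
    smul_add, AddCircle.toCircle_add, Circle.coe_mul]
  ring

theorem pd_mFourier (n : Fin 2 → ℤ) (j : Fin 2) (x : T2) :
    pd j (mFourier n) x = 2 * Real.pi * Complex.I * n j * mFourier n x := by
  have h (t : ℝ) : mFourier n (Pi.single j (t : UnitAddCircle)) =
      Complex.exp (2 * Real.pi * Complex.I * n j * t) := by
    have h0 : (Pi.single j (t : UnitAddCircle) : T2) = proj (Pi.single j t) := by
      funext i
      by_cases hij : i = j
      · subst hij; simp [proj]
      · simp [proj, hij]
    rw [h0, mFourier_proj]
    congr 1
    fin_cases j <;> simp <;> ring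
  have hd : HasDerivAt (fun t : ℝ => mFourier n x * Complex.exp (2 * Real.pi * Complex.I * n j * t))
      (mFourier n x * (2 * Real.pi * Complex.I * n j)) 0 := by
    have h1 := ((hasDerivAt_id (0 : ℝ)).ofReal_comp.const_mul
      (2 * Real.pi * Complex.I * n j)).cexp.const_mul (mFourier n x)
    simpa using h1
  rw [pd]
  simp only [mFourier_add_apply, h]
  rw [hd.deriv, mul_comm]

theorem mFourierCoeff_eq_integral (f : T2 → ℂ) (k : Fin 2 → ℤ) :
    mFourierCoeff f k = ∫ x, mFourier (-k) x * f x ∂vol := rfl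

theorem IsSmooth.mul {f g : T2 → ℂ} (hf : IsSmooth f) (hg : IsSmooth g) :
    IsSmooth fun x => f x * g x :=
  ContDiff.mul hf hg

/-- Integration by parts: the derivative of the product of f with the character of frequency -k has
integral zero. -/
theorem mFourierCoeff_pd {f : T2 → ℂ} (hf : IsSmooth f) (j : Fin 2) (k : Fin 2 → ℤ) :
    mFourierCoeff (pd j f) k = 2 * Real.pi * Complex.I * k j * mFourierCoeff f k := by
  have he := isSmooth_mFourier (-k)
  have h := integral_pd j (he.mul hf)
  have h2 (x : T2) : pd j (fun y => mFourier (-k) y * f y) x =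
      mFourier (-k) x * pd j f x - 2 * Real.pi * Complex.I * k j * (mFourier (-k) x * f x) := by
    rw [pd_mul he hf, pd_mFourier]
    simp only [Pi.neg_apply, Int.cast_neg]
    ring
  simp only [h2] at h
  rw [integral_sub (he.mul (hf.pd j)).integrable ((he.mul hf).integrable.const_mul _),
    integral_const_mul, sub_eq_zero] at h
  exact h

theorem isSmooth_ofReal {f : T2 → ℝ} (hf : IsSmooth f) : IsSmooth fun x => (f x : ℂ) :=
  hf.clm_comp Complex.ofRealCLM

theorem mFourierCoeff_ofReal_pd {f : T2 → ℝ} (hf : IsSmooth f) (j : Fin 2) (k : Fin 2 → ℤ) :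
    mFourierCoeff (fun x => ((pd j f x : ℝ) : ℂ)) k =
      2 * Real.pi * Complex.I * k j * mFourierCoeff (fun x => (f x : ℂ)) k := by
  rw [← mFourierCoeff_pd (isSmooth_ofReal hf)]
  congr 1
  exact funext fun x => (pd_comp_clm Complex.ofRealCLM j hf x).symm

end Fourier

/-! ### Fourier modes of Weyl spinors -/

section Modes

/-- The constant spinor of chirality `1` for `i = 0` and of chirality `-1` for `i = 1`, multiplied
by the character of frequency `n`. -/
def mode (n : Fin 2 → ℤ) (i : Fin 2) : Spinor :=
  ⟨fun x => mFourier n x • (Pi.single i 1 : Fin 2 → ℂ), by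
    change IsSmooth fun x => mFourier n x • (Pi.single i 1 : Fin 2 → ℂ)
    exact ContDiff.smul (isSmooth_mFourier n) contDiff_const⟩

/-- The chirality of the `i`-th standard basis vector of `ℂ²`. -/
def sign : Fin 2 → ℂ := ![1, -1]

theorem mode_apply (n : Fin 2 → ℤ) (i : Fin 2) (x : T2) :
    (mode n i).1 x = mFourier n x • Pi.single i 1 := rfl

theorem mode_apply_same (n : Fin 2 → ℤ) (i : Fin 2) (x : T2) :
    (mode n i).1 x i = mFourier n x := by simp [mode_apply]

theorem isSmooth_component (ψ : Spinor) (i : Fin 2) : IsSmooth fun x => ψ.1 x i :=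
  contDiff_pi.1 (show IsSmooth ψ.1 from ψ.2) i

theorem pd_component (j : Fin 2) (ψ : Spinor) (i : Fin 2) (x : T2) :
    pd j ψ.1 x i = pd j (fun y => ψ.1 y i) x :=
  (pd_comp_clm (ContinuousLinearMap.proj (R := ℝ) (φ := fun _ : Fin 2 => ℂ) i) j ψ.2 x).symm

theorem pd_mode_apply_same (j : Fin 2) (n : Fin 2 → ℤ) (i : Fin 2) (x : T2) :
    pd j (mode n i).1 x i = 2 * Real.pi * Complex.I * n j * mFourier n x := by
  rw [pd_component, ← pd_mFourier]
  simp only [mode_apply_same]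

theorem chirality_apply (ψ : Spinor) (x : T2) (i : Fin 2) :
    (chirality ψ).1 x i = sign i * ψ.1 x i := by
  rw [chirality_eq]
  change Matrix.mulVec _ (ψ.1 x) i = _
  fin_cases i <;> simp [sign, Matrix.mulVec, dotProduct]

theorem mem_weyl_iff {s : ℂ} {ψ : Spinor} :
    ψ ∈ Weyl s ↔ ∀ x i, sign i * ψ.1 x i = s * ψ.1 x i := by
  rw [Module.End.mem_eigenspace_iff]
  constructor
  · intro h x i
    rw [← chirality_apply, h]
    rfl
  · exact fun h => Spinor.ext fun x => funext fun i => (chirality_apply ψ x i).trans (h x i)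

theorem mode_mem_weyl (n : Fin 2 → ℤ) (i : Fin 2) : mode n i ∈ Weyl (sign i) := by
  rw [mem_weyl_iff]
  intro x j
  by_cases h : j = i
  · rw [h]
  · simp [mode_apply, h]

theorem translate_mode (a : T2) (n : Fin 2 → ℤ) (i : Fin 2) :
    translate a (mode n i) = mFourier n (-a) • mode n i := by
  refine Spinor.ext fun x => ?_
  change mFourier n (x - a) • (Pi.single i 1 : Fin 2 → ℂ) =
    mFourier n (-a) • mFourier n x • (Pi.single i 1 : Fin 2 → ℂ)
  rw [sub_eq_add_neg, mFourier_add_apply, mul_comm, mul_smul]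

/-- A Weyl spinor of negative chirality on which translations act by a character is a multiple of
the mode of that frequency. -/
theorem eq_smul_mode_of_translate {ψ : Spinor} (hψ : ψ ∈ Weyl (-1)) {n : Fin 2 → ℤ}
    (h : ∀ a, translate a ψ = mFourier n (-a) • ψ) : ψ = ψ.1 0 1 • mode n 1 := by
  refine Spinor.ext fun x => funext fun i => ?_
  -- Translating by -x and evaluating at 0 recovers ψ(x) from ψ(0).
  have hx : ψ.1 (0 - -x) i = mFourier n (- -x) * ψ.1 0 i :=
    congrFun (congrFun (congrArg Subtype.val (h (-x))) 0) i
  rw [zero_sub, neg_neg] at hx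
  change ψ.1 x i = ψ.1 0 1 * (mode n 1).1 x i
  rw [hx]
  fin_cases i
  · have h0 := mem_weyl_iff.1 hψ 0 0
    have h1 : ψ.1 0 0 = 0 := by
      simp only [sign, Matrix.cons_val_zero] at h0
      linear_combination h0 / 2
    simp [mode_apply, h1]
  · simp [mode_apply, mul_comm]

theorem l2_smul_smul (c d : ℂ) (φ ψ : Spinor) :
    l2 (c • φ) (d • ψ) = star c * d * l2 φ ψ := by
  have h (x : T2) : star ((c • φ).1 x) ⬝ᵥ (d • ψ).1 x =
      star c * d * (star (φ.1 x) ⬝ᵥ ψ.1 x) := by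
    change star (c • φ.1 x) ⬝ᵥ (d • ψ.1 x) = _
    rw [star_smul, smul_dotProduct, dotProduct_smul, smul_eq_mul, smul_eq_mul, mul_assoc]
  simp only [l2, h]
  exact integral_const_mul _ _

theorem l2_mode (m : Fin 2 → ℤ) (i : Fin 2) (ψ : Spinor) :
    l2 (mode m i) ψ = mFourierCoeff (fun x => ψ.1 x i) m := by
  rw [mFourierCoeff_eq_integral]
  refine integral_congr_ae (Filter.Eventually.of_forall fun x => ?_)
  change star (mFourier m x • Pi.single i 1) ⬝ᵥ ψ.1 x = mFourier (-m) x * ψ.1 x i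
  rw [mFourier_neg, star_smul, smul_dotProduct, smul_eq_mul, ← Pi.single_star, star_one,
    single_one_dotProduct]
  rfl

end Modes

/-! ### Matrix elements of the Kosmann–Lichnerowicz derivative -/

section Kosmann

/-- The two off-diagonal terms of the double sum coincide and v₁ · v₂ · = -iΓ, so -1/8 becomes (i/4)
Γ times the curl of X. -/
theorem kosmann_apply (X : VectorField) (ψ : Spinor) (x : T2) (i : Fin 2) :
    (kosmann X ψ).1 x i = X.toFun x 0 * pd 0 ψ.1 x i + X.toFun x 1 * pd 1 ψ.1 x i
      + Complex.I / 4 * sign i * (X.antisymmDeriv 0 1).toFun x * ψ.1 x i := by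
  have h00 : (X.antisymmDeriv 0 0).toFun x = 0 := sub_self _
  have h11 : (X.antisymmDeriv 1 1).toFun x = 0 := sub_self _
  have h10 : (X.antisymmDeriv 1 0).toFun x = -(X.antisymmDeriv 0 1).toFun x :=
    (neg_sub _ _).symm
  have h : (kosmann X ψ).1 x i =
      (∑ j, X.toFun x j • pd j ψ.1 x i) - (1 / 8 : ℂ) • ∑ j, ∑ k, (X.antisymmDeriv j k).toFun x •
        (gam j).mulVec ((gam k).mulVec (ψ.1 x)) i := by
    simp only [kosmann, Fin.sum_univ_two]
    rfl
  rw [h]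
  simp only [Fin.sum_univ_two, h00, h11, h10, Complex.real_smul, smul_eq_mul]
  fin_cases i <;> simp [gam, sign, Matrix.mulVec, dotProduct] <;> ring

/-- The Fourier coefficients of `L_X` applied to a mode. -/
theorem mFourierCoeff_kosmann_mode (X : VectorField) (m n : Fin 2 → ℤ) (i : Fin 2) :
    mFourierCoeff (fun x => (kosmann X (mode n i)).1 x i) m =
      2 * Real.pi * Complex.I * n 0 * mFourierCoeff (fun x => (X.toFun x 0 : ℂ)) (m - n)
      + 2 * Real.pi * Complex.I * n 1 * mFourierCoeff (fun x => (X.toFun x 1 : ℂ)) (m - n)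
      + Complex.I / 4 * sign i *
        mFourierCoeff (fun x => ((X.antisymmDeriv 0 1).toFun x : ℂ)) (m - n) := by
  have he := isSmooth_mFourier (-(m - n))
  have hX (j : Fin 2) := (he.mul (isSmooth_ofReal (X.smooth_component j))).integrable
  have hω := (he.mul (isSmooth_ofReal (X.antisymmDeriv 0 1).smooth)).integrable
  simp only [mFourierCoeff_eq_integral]
  rw [← integral_const_mul, ← integral_const_mul, ← integral_const_mul,
    ← integral_add ((hX 0).const_mul _) ((hX 1).const_mul _),
    ← integral_add _ (hω.const_mul _)]
  rotate_left
  · exact ((hX 0).const_mul _).add ((hX 1).const_mul _)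
  refine integral_congr_ae (Filter.Eventually.of_forall fun x => ?_)
  have hmul : mFourier (-(m - n)) x = mFourier (-m) x * mFourier n x := by
    rw [← mFourier_add, neg_sub, sub_eq_add_neg, add_comm]
  simp only [kosmann_apply, pd_mode_apply_same, mode_apply_same, hmul]
  ring

theorem mFourierCoeff_hamiltonianField_zero (h : SmoothFunction) (k : Fin 2 → ℤ) :
    mFourierCoeff (fun x => ((hamiltonianField h).toFun x 0 : ℂ)) k =
      2 * Real.pi * Complex.I * k 1 * fourierCoefficient h k :=
  mFourierCoeff_ofReal_pd h.smooth 1 k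

theorem mFourierCoeff_hamiltonianField_one (h : SmoothFunction) (k : Fin 2 → ℤ) :
    mFourierCoeff (fun x => ((hamiltonianField h).toFun x 1 : ℂ)) k =
      -(2 * Real.pi * Complex.I * k 0 * fourierCoefficient h k) := by
  rw [fourierCoefficient, ← mFourierCoeff_ofReal_pd h.smooth 0 k, mFourierCoeff_eq_integral,
    mFourierCoeff_eq_integral, ← integral_neg]
  refine integral_congr_ae (Filter.Eventually.of_forall fun x => ?_)
  change _ * ((-pd 0 h.toFun x : ℝ) : ℂ) = _
  push_cast
  ring

theorem mFourierCoeff_antisymmDeriv (X : VectorField) (k : Fin 2 → ℤ) :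
    mFourierCoeff (fun x => ((X.antisymmDeriv 0 1).toFun x : ℂ)) k =
      2 * Real.pi * Complex.I * k 0 * mFourierCoeff (fun x => (X.toFun x 1 : ℂ)) k
      - 2 * Real.pi * Complex.I * k 1 * mFourierCoeff (fun x => (X.toFun x 0 : ℂ)) k := by
  have he := isSmooth_mFourier (-k)
  have hX (i j : Fin 2) := (he.mul (isSmooth_ofReal ((X.smooth_component i).pd j))).integrable
  rw [← mFourierCoeff_ofReal_pd (X.smooth_component 1), ←
    mFourierCoeff_ofReal_pd (X.smooth_component 0)]
  simp only [mFourierCoeff_eq_integral]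
  rw [← integral_sub (hX 1 0) (hX 0 1)]
  refine integral_congr_ae (Filter.Eventually.of_forall fun x => ?_)
  change _ * ((pd 0 (fun x => X.toFun x 1) x - pd 1 (fun x => X.toFun x 0) x : ℝ) : ℂ) = _
  push_cast
  ring

/-- The matrix elements of `L_X` between modes, for the Hamiltonian field `X` of `h`. -/
theorem l2_mode_kosmann_mode (h : SmoothFunction) (n k : Fin 2 → ℤ) (i : Fin 2) :
    l2 (mode (n + k) i) (kosmann (hamiltonianField h) (mode n i)) =
      -4 * Real.pi ^ 2 * fourierCoefficient h k *
        (n 0 * k 1 - n 1 * k 0 - sign i * Complex.I / 4 * (k 0 ^ 2 + k 1 ^ 2)) := by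
  -- The transport term gives n × k; the curl of X_h is -Δh, with coefficient 4π²|k|² ĥ(k).
  rw [l2_mode, mFourierCoeff_kosmann_mode, add_sub_cancel_left, mFourierCoeff_antisymmDeriv,
    mFourierCoeff_hamiltonianField_zero, mFourierCoeff_hamiltonianField_one]
  linear_combination (4 * Real.pi ^ 2 * fourierCoefficient h k * (n 0 * k 1 - n 1 * k 0)
    - sign i * Complex.I * Real.pi ^ 2 * fourierCoefficient h k * (k 0 ^ 2 + k 1 ^ 2))
      * Complex.I_sq

end Kosmann

/-! ### Failure of strong and weak chiral symmetry -/

section Symmetry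

theorem dirac_apply_one (ψ : Spinor) (x : T2) :
    (dirac ψ).1 x 1 = -Complex.I * pd 0 (fun y => ψ.1 y 0) x + pd 1 (fun y => ψ.1 y 0) x := by
  have h : (dirac ψ).1 x 1 = ∑ j, (gam j).mulVec (pd j ψ.1 x) 1 := by
    simp only [dirac, Fin.sum_univ_two]
    rfl
  rw [h, ← pd_component, ← pd_component]
  simp [gam, Matrix.mulVec, dotProduct]

/-- On the upper component D is -i(∂₁ + i∂₂), a Cauchy–Riemann operator whose symbol 2π(k₀ + ik₁)
vanishes only at k = 0. -/
theorem mFourierCoeff_eq_zero_of_dirac_eq_zero {ψ : Spinor} (hψ : dirac ψ = 0) {k : Fin 2 → ℤ}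
    (hk : k ≠ 0) : mFourierCoeff (fun x => ψ.1 x 0) k = 0 := by
  have hs := isSmooth_component ψ 0
  have he := isSmooth_mFourier (-k)
  have hI (j : Fin 2) := (he.mul (hs.pd j)).integrable
  have h1 : -Complex.I * mFourierCoeff (pd 0 fun x => ψ.1 x 0) k
      + mFourierCoeff (pd 1 fun x => ψ.1 x 0) k = 0 := by
    simp only [mFourierCoeff_eq_integral]
    rw [← integral_const_mul, ← integral_add ((hI 0).const_mul _) (hI 1)]
    refine (integral_congr_ae (Filter.Eventually.of_forall fun x => ?_)).trans (integral_zero T2 ℂ)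
    have hx : (dirac ψ).1 x 1 = 0 := by rw [hψ]; rfl
    rw [dirac_apply_one] at hx
    change -Complex.I * (mFourier (-k) x * _) + mFourier (-k) x * _ = 0
    linear_combination mFourier (-k) x * hx
  rw [mFourierCoeff_pd hs, mFourierCoeff_pd hs] at h1
  have h2 : (2 * Real.pi : ℂ) * ((k 0 + k 1 * Complex.I) * mFourierCoeff (fun x => ψ.1 x 0) k)
      = 0 := by
    linear_combination h1 + 2 * Real.pi * k 0 * mFourierCoeff (fun x => ψ.1 x 0) k * Complex.I_sq
  have hpi : (2 * Real.pi : ℂ) ≠ 0 := by simp [Real.pi_ne_zero]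
  refine ((mul_eq_zero.1 ((mul_eq_zero.1 h2).resolve_left hpi)).resolve_left fun hz => hk ?_)
  have hre := congrArg Complex.re hz
  have him := congrArg Complex.im hz
  simp at hre him
  funext i
  fin_cases i
  · exact hre
  · exact him

theorem sq_add_sq_pos_of_ne_zero {k : Fin 2 → ℤ} (hk : k ≠ 0) :
    0 < (k 0 : ℝ) ^ 2 + (k 1 : ℝ) ^ 2 := by
  by_contra hle
  refine hk (funext fun i => ?_)
  have h0 : (k 0 : ℝ) = 0 := by nlinarith [sq_nonneg (k 0 : ℝ), sq_nonneg (k 1 : ℝ)]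
  have h1 : (k 1 : ℝ) = 0 := by nlinarith [sq_nonneg (k 0 : ℝ), sq_nonneg (k 1 : ℝ)]
  fin_cases i
  · exact_mod_cast h0
  · exact_mod_cast h1

theorem dirac_mode_zero (i : Fin 2) : dirac (mode 0 i) = 0 := by
  have hpd (j : Fin 2) : nabla j (mode 0 i) = 0 := by
    refine Spinor.ext fun x => ?_
    change pd j (mode 0 i).1 x = 0
    simp [pd, mode_apply, mFourier_zero]
  simp only [dirac, Fin.sum_univ_two, LinearMap.add_apply, Module.End.mul_apply, hpd, map_zero,
    add_zero]

/-- If `L_X` preserves the harmonic spinors, then `h` has no non-zero frequencies. -/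
theorem fourierCoefficient_eq_zero_of_preserves_kernel {h : SmoothFunction}
    (hker : ∀ ψ ∈ LinearMap.ker dirac, kosmann (hamiltonianField h) ψ ∈ LinearMap.ker dirac)
    {k : Fin 2 → ℤ} (hk : k ≠ 0) : fourierCoefficient h k = 0 := by
  have h1 := mFourierCoeff_eq_zero_of_dirac_eq_zero
    (LinearMap.mem_ker.1 (hker _ (LinearMap.mem_ker.2 (dirac_mode_zero 0)))) hk
  have h2 := l2_mode_kosmann_mode h 0 k 0
  rw [zero_add, l2_mode, h1] at h2
  have h3 : ((k 0 : ℂ) ^ 2 + (k 1 : ℂ) ^ 2) ≠ 0 := by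
    exact_mod_cast (sq_add_sq_pos_of_ne_zero hk).ne'
  have h4 : Complex.I * Real.pi ^ 2 * ((k 0 : ℂ) ^ 2 + (k 1 : ℂ) ^ 2) ≠ 0 :=
    mul_ne_zero (mul_ne_zero Complex.I_ne_zero (by simp [Real.pi_ne_zero])) h3
  refine (mul_eq_zero.1 ?_).resolve_left h4
  simp only [sign, Pi.zero_apply, Int.cast_zero, Matrix.cons_val_zero] at h2
  linear_combination -h2

/-- The phases of a chirality isomorphism satisfy incompatible relations along the two ways from
`0` to the sum of two independent frequencies. -/
theorem phases_incompatible {a b d : ℝ} (ha : 0 < a) (hb : 0 < b) (hd : d ≠ 0)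
    {θ₀ θk θl w : ℂ} (hk : star θk * θ₀ * (Complex.I * a) = -(Complex.I * a))
    (hl : star θl * θ₀ * (Complex.I * b) = -(Complex.I * b))
    (hkl : w * θk * (d + Complex.I * b) = d - Complex.I * b)
    (hlk : w * θl * (-d + Complex.I * a) = -d - Complex.I * a) : False := by
  have hIa : Complex.I * (a : ℂ) ≠ 0 := mul_ne_zero Complex.I_ne_zero (by exact_mod_cast ha.ne')
  have hIb : Complex.I * (b : ℂ) ≠ 0 := mul_ne_zero Complex.I_ne_zero (by exact_mod_cast hb.ne')
  have hk' : star θk * θ₀ = -1 := mul_right_cancel₀ hIa (hk.trans (by ring))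
  have hl' : star θl * θ₀ = -1 := mul_right_cancel₀ hIb (hl.trans (by ring))
  have hθ₀ : θ₀ ≠ 0 := by
    rintro rfl
    simp at hk'
  -- Both conjugates equal -1/θ₀.
  have hθ : θk = θl := star_injective (mul_right_cancel₀ hθ₀ (hk'.trans hl'.symm))
  subst hθ
  -- Cross-multiplying `hkl` and `hlk` eliminates the common factor w θ.
  have hI : Complex.I * (d * (a + b) : ℝ) = 0 := by
    push_cast
    linear_combination (d + Complex.I * b) / 2 * hlk - (-(d : ℂ) + Complex.I * a) / 2 * hkl
  have hI' : d * (a + b) = 0 := by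
    exact_mod_cast (mul_eq_zero.1 hI).resolve_left Complex.I_ne_zero
  exact mul_ne_zero hd (add_pos ha hb).ne' hI'

/-- A chirality isomorphism multiplies each mode by a constant. -/
theorem IsChiralityIsomorphism.exists_phase {Θ : Weyl 1 ≃ₗ[ℂ] Weyl (-1)}
    (hΘ : IsChiralityIsomorphism Θ) (n : Fin 2 → ℤ) :
    ∃ θ : ℂ, (Θ ⟨mode n 0, mode_mem_weyl n 0⟩ : Spinor) = θ • mode n 1 := by
  refine ⟨_, eq_smul_mode_of_translate (Θ _).2 fun a => ?_⟩
  have h := congrArg Subtype.val (hΘ.equivariant a ⟨mode n 0, mode_mem_weyl n 0⟩)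
  have h1 : restrictWeyl (commute_chirality_translate a) 1 ⟨mode n 0, mode_mem_weyl n 0⟩ =
      mFourier n (-a) • (⟨mode n 0, mode_mem_weyl n 0⟩ : Weyl 1) :=
    Subtype.ext (translate_mode a n 0)
  rw [h1, map_smul] at h
  exact h.symm

theorem not_hasWeakChiralSymmetry {h : SmoothFunction} (hh : HasIndependentModes h) :
    ¬ HasWeakChiralSymmetry (hamiltonianField h) := by
  rintro ⟨Θ, hΘ, hcomm⟩
  obtain ⟨k, l, hd, hk, hl⟩ := hh
  choose θ hθ using hΘ.exists_phase
  have key (n q : Fin 2 → ℤ) (hq : fourierCoefficient h q ≠ 0) :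
      star (θ (n + q)) * θ n *
        ((n 0 * q 1 - n 1 * q 0 : ℝ) + Complex.I * ((q 0 ^ 2 + q 1 ^ 2 : ℝ) / 4 : ℝ)) =
        (n 0 * q 1 - n 1 * q 0 : ℝ) - Complex.I * ((q 0 ^ 2 + q 1 ^ 2 : ℝ) / 4 : ℝ) := by
    -- Intertwining and unitarity equate the matrix elements from n to n + q on the two chiralities;
    -- the common factor -4π² ĥ(q) then cancels.
    have h1 := (LinearEquiv.symm_apply_eq Θ).1 (hcomm ⟨mode n 0, mode_mem_weyl n 0⟩)
    have h2 := hΘ.unitary ⟨mode (n + q) 0, mode_mem_weyl _ 0⟩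
      (restrictWeyl (commute_chirality_kosmann (hamiltonianField h)) 1
        ⟨mode n 0, mode_mem_weyl n 0⟩)
    rw [← h1] at h2
    change l2 (Θ ⟨mode (n + q) 0, mode_mem_weyl _ 0⟩ : Spinor)
      (kosmann (hamiltonianField h) (Θ ⟨mode n 0, mode_mem_weyl n 0⟩ : Spinor)) =
      l2 (mode (n + q) 0) (kosmann (hamiltonianField h) (mode n 0)) at h2
    rw [hθ, hθ, map_smul, l2_smul_smul, l2_mode_kosmann_mode, l2_mode_kosmann_mode] at h2
    have hc : -4 * (Real.pi : ℂ) ^ 2 * fourierCoefficient h q ≠ 0 :=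
      mul_ne_zero (by simp [Real.pi_ne_zero]) hq
    refine mul_left_cancel₀ hc ?_
    simp only [sign, Matrix.cons_val_zero, Matrix.cons_val_one] at h2
    push_cast
    linear_combination h2
  have hk0 : k ≠ 0 := by rintro rfl; simp at hd
  have hl0 : l ≠ 0 := by rintro rfl; simp at hd
  have e1 := key 0 k hk
  have e2 := key 0 l hl
  have e3 := key k l hl
  have e4 := key l k hk
  rw [add_comm l k] at e4
  refine phases_incompatible (a := ((k 0 : ℝ) ^ 2 + (k 1 : ℝ) ^ 2) / 4)
    (b := ((l 0 : ℝ) ^ 2 + (l 1 : ℝ) ^ 2) / 4) (d := k 0 * l 1 - k 1 * l 0)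
    (θ₀ := θ 0) (θk := θ k) (θl := θ l) (w := star (θ (k + l)))
    (div_pos (sq_add_sq_pos_of_ne_zero hk0) four_pos)
    (div_pos (sq_add_sq_pos_of_ne_zero hl0) four_pos) (by exact_mod_cast hd) ?_ ?_ e3 ?_
  · simpa using e1
  · simpa using e2
  -- The second path has determinant l × k = -d.
  · push_cast at e4 ⊢
    linear_combination e4

theorem not_hasStrongChiralSymmetry {h : SmoothFunction} (hh : HasIndependentModes h) :
    ¬ HasStrongChiralSymmetry (hamiltonianField h) := by
  obtain ⟨k, l, hd, hk, -⟩ := hh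
  have hk0 : k ≠ 0 := by rintro rfl; simp at hd
  exact fun hs => hk (fourierCoefficient_eq_zero_of_preserves_kernel hs.preserves_kernel hk0)

end Symmetry

/-! ### Convergence in the C^∞ topology -/

section SmoothTopology

variable {E : Type*} [NormedAddCommGroup E] [NormedSpace ℝ E]

theorem tendsto_smoothMap_iff {ι : Type*} {l : Filter ι} {F : ι → SmoothMap E} {f : SmoothMap E} :
    Tendsto F l (𝓝 f) ↔ ∀ a : ℕ × ℕ,
      TendstoUniformly (fun i => (pd 0)^[a.1] ((pd 1)^[a.2] (F i).toFun))
        ((pd 0)^[a.1] ((pd 1)^[a.2] f.toFun)) l := by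
  rw [nhds_induced, tendsto_comap_iff, tendsto_pi_nhds]
  exact forall_congr' fun a => UniformFun.tendsto_iff_tendstoUniformly

theorem IsSmooth.iterate_pd {f : T2 → E} (hf : IsSmooth f) (j : Fin 2) (a : ℕ) :
    IsSmooth ((TorusSpinors.pd j)^[a] f) := by
  induction a generalizing f with
  | zero => exact hf
  | succ a ih => exact ih (hf.pd j)

theorem IsSmooth.add_smul {f g : T2 → E} (hf : IsSmooth f) (hg : IsSmooth g) (c : ℝ) :
    IsSmooth fun x => f x + c • g x :=
  ContDiff.add hf (ContDiff.const_smul c hg)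

theorem pd_add_smul {f g : T2 → E} (hf : IsSmooth f) (hg : IsSmooth g) (j : Fin 2) (c : ℝ) :
    pd j (fun x => f x + c • g x) = fun x => pd j f x + c • pd j g x :=
  funext fun x =>
    ((hasDerivAt_line_zero j hf x).add ((hasDerivAt_line_zero j hg x).const_smul c)).deriv

theorem iterate_pd_add_smul {f g : T2 → E} (hf : IsSmooth f) (hg : IsSmooth g) (j : Fin 2)
    (a : ℕ) (c : ℝ) :
    (pd j)^[a] (fun x => f x + c • g x) = fun x => (pd j)^[a] f x + c • (pd j)^[a] g x := by
  induction a generalizing f g with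
  | zero => rfl
  | succ a ih =>
    simp only [Function.iterate_succ_apply]
    rw [pd_add_smul hf hg, ih (hf.pd j) (hg.pd j)]

/-- Each iterated derivative moves by c times a fixed function, bounded by compactness. -/
theorem tendsto_add_smul {f g : SmoothMap E} {F : ℝ → SmoothMap E}
    (hF : ∀ c, (F c).toFun = fun x => f.toFun x + c • g.toFun x) : Tendsto F (𝓝 0) (𝓝 f) := by
  rw [tendsto_smoothMap_iff]
  intro a
  have hg := (g.smooth.iterate_pd 1 a.2).iterate_pd 0 a.1
  obtain ⟨C, hC⟩ := hg.exists_norm_le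
  have hlim : Tendsto (fun c : ℝ => |c| * C) (𝓝 0) (𝓝 0) := by
    have h : Continuous fun c : ℝ => |c| * C := by fun_prop
    simpa using h.tendsto 0
  rw [Metric.tendstoUniformly_iff]
  intro ε hε
  filter_upwards [hlim.eventually (gt_mem_nhds hε)] with c hc x
  rw [hF, iterate_pd_add_smul f.smooth g.smooth, iterate_pd_add_smul (f.smooth.iterate_pd 1 a.2)
    (g.smooth.iterate_pd 1 a.2), dist_self_add_right, norm_smul, Real.norm_eq_abs]
  exact (mul_le_mul_of_nonneg_left (hC x) (abs_nonneg c)).trans_lt hc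

end SmoothTopology

/-! ### Openness -/

section Open

theorem norm_mFourier_apply (k : Fin 2 → ℤ) (x : T2) : ‖mFourier k x‖ = 1 := by
  simp only [mFourier, ContinuousMap.coe_mk, fourier_apply, norm_prod, Circle.norm_coe,
    Finset.prod_const_one]

theorem continuous_mFourierCoeff_component (k : Fin 2 → ℤ) (j : Fin 2) :
    Continuous fun X : VectorField => mFourierCoeff (fun x => (X.toFun x j : ℂ)) k := by
  refine continuous_iff_continuousAt.2 fun X => ?_
  -- The index (0, 0) is plain uniform convergence, which suffices here.
  have hX := (tendsto_smoothMap_iff (F := id) (f := X) (l := 𝓝 X)).1 tendsto_id (0, 0)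
  rw [Metric.tendstoUniformly_iff] at hX
  rw [ContinuousAt, Metric.tendsto_nhds]
  intro ε hε
  filter_upwards [hX (ε / 2) (half_pos hε)] with Y hY
  have hI (Z : VectorField) := ((isSmooth_mFourier (-k)).mul
    (isSmooth_ofReal (Z.smooth_component j))).integrable
  rw [mFourierCoeff_eq_integral, mFourierCoeff_eq_integral, dist_eq_norm,
    ← integral_sub (hI Y) (hI X)]
  have hle (x : T2) : ‖mFourier (-k) x * (Y.toFun x j : ℂ) - mFourier (-k) x * (X.toFun x j : ℂ)‖
      ≤ ε / 2 := by
    rw [← mul_sub, norm_mul, norm_mFourier_apply, one_mul, ← Complex.ofReal_sub,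
      Complex.norm_real, ← dist_eq_norm, dist_comm]
    exact (dist_le_pi_dist (X.toFun x) (Y.toFun x) j).trans (hY x).le
  refine (norm_integral_le_of_norm_le_const (Eventually.of_forall hle)).trans_lt ?_
  simpa using half_lt_self hε

/-- The coefficient of X_h at k is 2πi ĥ(k) (k₁, -k₀). With the converse below, this moves the
condition on h to X, where the topology lives; a nearby field comes with its own potential. -/
theorem exists_mFourierCoeff_ne_zero {h : SmoothFunction} {k : Fin 2 → ℤ} (hk : k ≠ 0)
    (hh : fourierCoefficient h k ≠ 0) :
    ∃ j, mFourierCoeff (fun x => ((hamiltonianField h).toFun x j : ℂ)) k ≠ 0 := by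
  by_contra hne
  push Not at hne
  have h0 := hne 0
  have h1 := hne 1
  rw [mFourierCoeff_hamiltonianField_zero] at h0
  rw [mFourierCoeff_hamiltonianField_one] at h1
  simp [Real.pi_ne_zero, hh] at h0 h1
  refine hk (funext fun i => ?_)
  fin_cases i
  · exact h1
  · exact h0

theorem fourierCoefficient_ne_zero_of_component {h : SmoothFunction} {k : Fin 2 → ℤ} {j : Fin 2}
    (hj : mFourierCoeff (fun x => ((hamiltonianField h).toFun x j : ℂ)) k ≠ 0) :
    fourierCoefficient h k ≠ 0 := by
  intro h0
  refine hj ?_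
  fin_cases j
  · exact (mFourierCoeff_hamiltonianField_zero h k).trans (by rw [h0, mul_zero])
  · exact (mFourierCoeff_hamiltonianField_one h k).trans (by rw [h0, mul_zero, neg_zero])

theorem isOpen_genericHamiltonianFields : IsOpen genericHamiltonianFields := by
  rw [isOpen_iff_mem_nhds]
  rintro X ⟨h, hX, k, l, hd, hk, hl⟩
  have hk0 : k ≠ 0 := by rintro rfl; simp at hd
  have hl0 : l ≠ 0 := by rintro rfl; simp at hd
  obtain ⟨i, hi⟩ := exists_mFourierCoeff_ne_zero hk0 hk
  obtain ⟨j, hj⟩ := exists_mFourierCoeff_ne_zero hl0 hl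
  rw [← hX] at hi hj
  have hc (q : Fin 2 → ℤ) (r : Fin 2) := (continuous_mFourierCoeff_component q r).comp
    (continuous_subtype_val (p := fun X : VectorField => ∃ h, X = hamiltonianField h))
  filter_upwards [(hc k i).continuousAt.eventually_ne hi, (hc l j).continuousAt.eventually_ne hj]
    with Y hYi hYj
  obtain ⟨Y, g, rfl⟩ := Y
  exact ⟨g, rfl, k, l, hd, fourierCoefficient_ne_zero_of_component hYi,
    fourierCoefficient_ne_zero_of_component hYj⟩

end Open

/-! ### Density -/

section Dense

/-- A nontrivial character is, up to a nonzero constant, its own partial derivative in some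
direction, so `integral_pd` applies. -/
theorem integral_mFourier (n : Fin 2 → ℤ) :
    ∫ x, mFourier n x ∂vol = if n = 0 then 1 else 0 := by
  split_ifs with hn
  · subst hn
    simp [mFourier_zero]
  · obtain ⟨j, hj⟩ := Function.ne_iff.1 hn
    have h := integral_pd j (isSmooth_mFourier n)
    simp only [pd_mFourier] at h
    rw [integral_const_mul] at h
    refine (mul_eq_zero.1 h).resolve_left ?_
    simpa [Real.pi_ne_zero] using hj

/-- The function `x ↦ cos (2π n · x)`. -/
def cosMode (n : Fin 2 → ℤ) : SmoothFunction :=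
  ⟨fun x => (mFourier n x).re, (isSmooth_mFourier n).clm_comp Complex.reCLM⟩

theorem fourierCoefficient_cosMode (n k : Fin 2 → ℤ) :
    fourierCoefficient (cosMode n) k =
      ((if n = k then 1 else 0) + if -n = k then 1 else 0) / 2 := by
  have hI (m : Fin 2 → ℤ) := (isSmooth_mFourier m).integrable
  have h (x : T2) : mFourier (-k) x * ((mFourier n x).re : ℂ) =
      (mFourier (n - k) x + mFourier (-n - k) x) / 2 := by
    rw [sub_eq_add_neg, sub_eq_add_neg, mFourier_add, mFourier_add, mFourier_neg (n := n),
      Complex.re_eq_add_conj]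
    ring
  rw [fourierCoefficient, mFourierCoeff_eq_integral]
  change ∫ x, mFourier (-k) x * ((mFourier n x).re : ℂ) ∂vol = _
  simp only [h]
  rw [integral_div, integral_add (hI _) (hI _), integral_mFourier, integral_mFourier]
  simp only [sub_eq_zero]

/-- The function `f + c g`. -/
def addSmul (f g : SmoothFunction) (c : ℝ) : SmoothFunction :=
  ⟨fun x => f.toFun x + c • g.toFun x, f.smooth.add_smul g.smooth c⟩

theorem fourierCoefficient_addSmul (f g : SmoothFunction) (c : ℝ) (k : Fin 2 → ℤ) :
    fourierCoefficient (addSmul f g c) k =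
      fourierCoefficient f k + c * fourierCoefficient g k := by
  have hI (f : SmoothFunction) :=
    ((isSmooth_mFourier (-k)).mul (isSmooth_ofReal f.smooth)).integrable
  simp only [fourierCoefficient, mFourierCoeff_eq_integral]
  rw [← integral_const_mul, ← integral_add (hI f) ((hI g).const_mul _)]
  refine integral_congr_ae (Eventually.of_forall fun x => ?_)
  simp only [addSmul, smul_eq_mul]
  push_cast
  ring

theorem hamiltonianField_addSmul (f g : SmoothFunction) (c : ℝ) :
    (hamiltonianField (addSmul f g c)).toFun =
      fun x => (hamiltonianField f).toFun x + c • (hamiltonianField g).toFun x := by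
  funext x i
  have h (j : Fin 2) : pd j (addSmul f g c).toFun x = pd j f.toFun x + c • pd j g.toFun x :=
    congrFun (pd_add_smul f.smooth g.smooth j c) x
  fin_cases i
  · simp [hamiltonianField, h]
  · simp [hamiltonianField, h]
    ring

/-- At most one c is bad; the neighbourhood is punctured because that value is 0 when z = 0. -/
theorem eventually_add_mul_ne_zero (z : ℂ) {w : ℂ} (hw : w ≠ 0) :
    ∀ᶠ c : ℝ in 𝓝[≠] 0, z + c * w ≠ 0 := by
  by_cases hz : z = 0
  · filter_upwards [self_mem_nhdsWithin] with c hc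
    simpa [hz, hw] using hc
  · have h : Continuous fun c : ℝ => z + c * w := by fun_prop
    exact (h.continuousAt.eventually_ne (by simpa using hz)).filter_mono nhdsWithin_le_nhds

theorem dense_genericHamiltonianFields : Dense genericHamiltonianFields := by
  rintro ⟨X, h, rfl⟩
  -- One perturbation with nonzero coefficients at two independent frequencies serves every h.
  set g : SmoothFunction := addSmul (cosMode ![1, 0]) (cosMode ![0, 1]) 1 with hg
  have hg0 : fourierCoefficient g ![1, 0] ≠ 0 := by
    rw [hg, fourierCoefficient_addSmul, fourierCoefficient_cosMode, fourierCoefficient_cosMode]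
    simp
  have hg1 : fourierCoefficient g ![0, 1] ≠ 0 := by
    rw [hg, fourierCoefficient_addSmul, fourierCoefficient_cosMode, fourierCoefficient_cosMode]
    simp
  have hlim : Tendsto (fun c : ℝ =>
      (⟨hamiltonianField (addSmul h g c), _, rfl⟩ : HamiltonianField)) (𝓝[≠] 0)
      (𝓝 ⟨hamiltonianField h, h, rfl⟩) := by
    rw [tendsto_subtype_rng]
    exact (tendsto_add_smul (hamiltonianField_addSmul h g)).mono_left nhdsWithin_le_nhds
  refine mem_closure_of_tendsto hlim ?_
  filter_upwards [eventually_add_mul_ne_zero (fourierCoefficient h ![1, 0]) hg0,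
    eventually_add_mul_ne_zero (fourierCoefficient h ![0, 1]) hg1] with c h0 h1
  refine ⟨addSmul h g c, rfl, ![1, 0], ![0, 1], by simp, ?_, ?_⟩
  · rwa [fourierCoefficient_addSmul]
  · rwa [fourierCoefficient_addSmul]

end Dense

end TorusSpinors

end

theorem mainTheorem1 :
    IsOpen TorusSpinors.genericHamiltonianFields ∧
    Dense TorusSpinors.genericHamiltonianFields ∧
    ∀ X ∈ TorusSpinors.genericHamiltonianFields,
      ¬ TorusSpinors.HasStrongChiralSymmetry X.1 ∧ ¬ TorusSpinors.HasWeakChiralSymmetry X.1 := by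
  refine ⟨TorusSpinors.isOpen_genericHamiltonianFields,
    TorusSpinors.dense_genericHamiltonianFields, ?_⟩
  rintro ⟨_, _⟩ ⟨h, rfl, hh⟩
  exact ⟨TorusSpinors.not_hasStrongChiralSymmetry hh, TorusSpinors.not_hasWeakChiralSymmetry hh⟩
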